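/- Let $n\ge 0$ be an integer, $p\ge 1$ and $s>0$ real numbers, and $1/q=1-1/p$ (so $1/q=0$ if $p=1$). For $f:\mathbb R^n\to[0,\infty)$ let $\operatorname{supp} f$ be the closure of $\{f>0\}$. For $f,g:\mathbb R^n\to[0,\infty)$ with nonempty supports and $\lambda>0$ define $$[\lambda\times_{p,s}f](x)=\lambda^{s/p}f(\lambda^{-1/p}x),$$ $$[f\oplus_{p,s}g](z)=\sup\Big\{\big((1-t)^{1/q}f(x)^{1/s}+t^{1/q}g(y)^{1/s}\big)^s:\ x\in\operatorname{supp}f,\ y\in\operatorname{supp}g,\ t\in[0,1],\ z=(1-t)^{1/q}x+t^{1/q}y\Big\}\in[0,\infty],$$ where $0^0=1$ and the supremum of the empty set is $0$. The first variation is $$\tilde{\mathcal S}_{p,s}(f;g)=\frac{p}{n+s}\lim_{\varepsilon\to0^+}\frac{\int f\oplus_{p,s}(\varepsilon\times_{p,s}g)-\int f}{\varepsilon};$$ it is said to exist if $f\oplus_{p,s}(\varepsilon\times_{p,s}g)$ is Lebesgue measurable with finite integral for all sufficiently small $\varepsilon>0$ and the limit exists in $\mathbb R$. The function $g$ is $s$-concave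 if $\operatorname{supp}g$ is nonempty, compact and convex and $g(tx+(1-t)y)\ge\big(t\,g(x)^{1/s}+(1-t)g(y)^{1/s}\big)^s$ for all $x,y\in\operatorname{supp}g$ and $t\in[0,1]$. Let $f,g:\mathbb R^n\to[0,\infty)$ be integrable with nonempty supports. (i) If $\tilde{\mathcal S}_{p,s}(f;g)$ exists, then $$\tilde{\mathcal S}_{p,s}(f;g)\ \ge\ \Big(\int f\Big)^{1-\frac p{n+s}}\Big(\int g\Big)^{\frac p{n+s}},$$ where $0^0=1$, and where the right-hand side is read as $0$ if $\int f=0$ and $p>n+s$. (ii) If $s$ is an integer, $f=\lambda\times_{p,s}g$ for some $\lambda>0$, and $g$ is $s$-concave such that $\operatorname{supp}g$ has nonempty interior and contains the origin, then $\tilde{\mathcal S}_{p,s}(f;g)$ exists and equality holds in (i). -/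

import Mathlib

open MeasureTheory Set Filter Topology
open scoped ENNReal

/-- The `L_{p,s}` sum `f ⊕_{p,s} g` of two nonnegative functions. Here `1 - 1 / p` is `1 / q` for the
Hölder conjugate `q` of `p` (it is `0` for `p = 1`, and `0 ^ 0 = 1`). The supremum is taken in
`[0, ∞]`; it is `0` at a point `z` that has no admissible representation, i.e. outside
`supp f +_p supp g`. -/
noncomputable def lpSum {n : ℕ} (p s : ℝ) (f g : EuclideanSpace ℝ (Fin n) → ℝ)
    (z : EuclideanSpace ℝ (Fin n)) : ℝ≥0∞ :=
  sSup {v : ℝ≥0∞ | ∃ x ∈ tsupport f, ∃ y ∈ tsupport g, ∃ t ∈ Icc (0 : ℝ) 1,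
    z = (1 - t) ^ (1 - 1 / p) • x + t ^ (1 - 1 / p) • y ∧
    v = ENNReal.ofReal
      (((1 - t) ^ (1 - 1 / p) * f x ^ (1 / s) + t ^ (1 - 1 / p) * g y ^ (1 / s)) ^ s)}

/-- The dilation `a ×_{p,s} f`, for `a > 0`: `x ↦ a ^ (s / p) * f (a ^ (-1 / p) x)`. -/
noncomputable def lpScale {n : ℕ} (p s a : ℝ) (f : EuclideanSpace ℝ (Fin n) → ℝ)
    (x : EuclideanSpace ℝ (Fin n)) : ℝ :=
  a ^ (s / p) * f (a ^ (-(1 / p)) • x)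

/-- `f` is `s`-concave: it is nonnegative, its support is nonempty, compact and convex, and
`f ^ (1 / s)` is concave on the support. -/
def IsSConcave {n : ℕ} (s : ℝ) (f : EuclideanSpace ℝ (Fin n) → ℝ) : Prop :=
  (∀ x, 0 ≤ f x) ∧ (tsupport f).Nonempty ∧ IsCompact (tsupport f) ∧ Convex ℝ (tsupport f) ∧
    ∀ x ∈ tsupport f, ∀ y ∈ tsupport f, ∀ t ∈ Icc (0 : ℝ) 1,
      (t * f x ^ (1 / s) + (1 - t) * f y ^ (1 / s)) ^ s ≤ f (t • x + (1 - t) • y)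

/-- The first variation of `f` in the direction `g` exists and equals `S`: for all small `ε > 0` the
function `f ⊕_{p,s} (ε ×_{p,s} g)` is Lebesgue measurable with finite integral, and the one-sided
difference quotient of the integrals has a limit `L` with `S = p / (n + s) * L`. -/
def HasFirstVariation {n : ℕ} (p s : ℝ) (f g : EuclideanSpace ℝ (Fin n) → ℝ) (S : ℝ) : Prop :=
  (∀ᶠ ε : ℝ in 𝓝[>] 0, AEMeasurable (lpSum p s f (lpScale p s ε g)) volume ∧
    ∫⁻ z, lpSum p s f (lpScale p s ε g) z ≠ ∞) ∧
  ∃ L : ℝ, Tendsto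
      (fun ε : ℝ => ((∫⁻ z, lpSum p s f (lpScale p s ε g) z).toReal - ∫ x, f x) / ε)
      (𝓝[>] 0) (𝓝 L) ∧
    S = p / (n + s) * L

/-! Write `F`, `G` for the integrals of `f`, `g`. For fixed `t`, the sum dominates the `s`-mean of
`f` and `g` with weights `α = (1 - t)^(1/q)`, `β = t^(1/q)`. Rescaling to `α^s f(x/α)`, whose
integral is `α^(n+s) F`, and applying the Borell-Brascamp-Lieb inequality bounds the integral of the
sum below by `(α F^(1/(n+s)) + β G^(1/(n+s)))^(n+s)`. The best `t`, the equality case of Hölder,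
turns this into `(F^κ + G^κ)^(1/κ)` with `κ = p/(n+s)`. Replacing `g` by `ε ×_{p,s} g` multiplies
`G^κ` by `ε`, so differentiating at `ε = 0` gives (i).

Borell-Brascamp-Lieb itself comes from Brunn-Minkowski on superlevel sets in dimension one, and from
Fubini in higher dimension. For equality, concavity together with `0 ∈ supp g` makes the dilates of
`g` add exactly, so every integral is an explicit power. -/

/-! ### Borell-Brascamp-Lieb on the line -/

/-- The one-dimensional Brunn-Minkowski inequality for nonempty compact sets, where the Minkowski
sum is only required to be contained in `C` up to a null set. -/
theorem volume_add_le_of_isCompact {K L C : Set ℝ} (hK : IsCompact K) (hL : IsCompact L)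
    (hK0 : K.Nonempty) (hL0 : L.Nonempty)
    (h : ∀ᵐ z : ℝ, ∀ x ∈ K, ∀ y ∈ L, x + y = z → z ∈ C) :
    volume K + volume L ≤ volume C := by
  obtain ⟨a, ha⟩ := hK.exists_isGreatest hK0
  obtain ⟨b, hb⟩ := hL.exists_isLeast hL0
  have hK' : volume ((fun x => x + b) '' K) = volume K := by
    simp [image_add_right, measure_preimage_add_right]
  have hL' : volume ((fun y => a + y) '' L) = volume L := by
    simp [image_add_left, measure_preimage_add]
  -- With `a = max K` and `b = min L`, the translate `K + b` lies to the left of `a + b` and `a + L`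
  -- to its right.
  have hdisj : AEDisjoint volume ((fun x => x + b) '' K) ((fun y => a + y) '' L) := by
    refine measure_mono_null (t := {a + b}) ?_ (by simp)
    rintro z ⟨⟨x, hx, rfl⟩, ⟨y, hy, hxy⟩⟩
    have h1 := ha.2 hx
    have h2 := hb.2 hy
    simp only [mem_singleton_iff] at *
    linarith
  rw [← hK', ← hL', ← measure_union₀ (hL.image (by fun_prop)).measurableSet.nullMeasurableSet hdisj]
  refine measure_mono_ae ?_
  filter_upwards [h] with z hz hzU
  rcases hzU with ⟨x, hx, rfl⟩ | ⟨y, hy, rfl⟩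
  · exact hz x hx b hb.1 rfl
  · exact hz a ha.1 y hy rfl

/-- The one-dimensional Brunn-Minkowski inequality for nonempty measurable sets, where the
Minkowski sum is only required to be contained in `C` up to a null set. -/
theorem volume_add_le_of_measurableSet {A B C : Set ℝ} (hA : MeasurableSet A)
    (hB : MeasurableSet B) (hA0 : A.Nonempty) (hB0 : B.Nonempty)
    (h : ∀ᵐ z : ℝ, ∀ x ∈ A, ∀ y ∈ B, x + y = z → z ∈ C) :
    volume A + volume B ≤ volume C := by
  have key : ∀ K ⊆ A, IsCompact K → ∀ L ⊆ B, IsCompact L → volume K + volume L ≤ volume C := by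
    intro K hKA hK L hLB hL
    obtain ⟨a, ha⟩ := hA0
    obtain ⟨b, hb⟩ := hB0
    calc volume K + volume L ≤ volume (insert a K) + volume (insert b L) := by
          gcongr <;> exact subset_insert _ _
      _ ≤ volume C := by
          refine volume_add_le_of_isCompact (hK.insert a) (hL.insert b) (insert_nonempty _ _)
            (insert_nonempty _ _) ?_
          filter_upwards [h] with z hz x hx y hy
          exact hz x (insert_subset ha hKA hx) y (insert_subset hb hLB hy)
  rw [hA.measure_eq_iSup_isCompact, hB.measure_eq_iSup_isCompact]
  simp only [iSup_and']
  exact ENNReal.biSup_add_biSup_le' ⟨∅, empty_subset _, isCompact_empty⟩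
    ⟨∅, empty_subset _, isCompact_empty⟩ fun K hK L hL => key K hK.1 hK.2 L hL.1 hL.2

/-- If `min (f x) (g y) ≤ h (x + y)` and `f`, `g` have the same supremum `1`, then
`∫ f + ∫ g ≤ ∫ h`. -/
theorem lintegral_add_lintegral_le_of_min_le {f g h : ℝ → ℝ≥0∞} (hf : Measurable f)
    (hg : Measurable g) (hh : Measurable h) (hf1 : ⨆ x, f x = 1) (hg1 : ⨆ x, g x = 1)
    (H : ∀ᵐ z : ℝ, ∀ x y, x + y = z → min (f x) (g y) ≤ h z) :
    (∫⁻ x, f x) + ∫⁻ x, g x ≤ ∫⁻ x, h x := by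
  have hfle : ∀ x, f x ≤ 1 := fun x => hf1 ▸ le_iSup f x
  have hgle : ∀ x, g x ≤ 1 := fun x => hg1 ▸ le_iSup g x
  have layer : ∀ u : ℝ → ℝ≥0∞, Measurable u → (∀ x, u x ≤ 1) →
      ∫⁻ x, u x = ∫⁻ t in Ioi (0 : ℝ), volume {x | ENNReal.ofReal t < u x} := by
    intro u hu hu1
    have hfin : ∀ x, u x ≠ ∞ := fun x => ((hu1 x).trans_lt ENNReal.one_lt_top).ne
    calc ∫⁻ x, u x = ∫⁻ x, ENNReal.ofReal (u x).toReal := by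
          simp only [ENNReal.ofReal_toReal (hfin _)]
      _ = ∫⁻ t in Ioi (0 : ℝ), volume {x | t < (u x).toReal} :=
          lintegral_eq_lintegral_meas_lt _ (Eventually.of_forall fun x => ENNReal.toReal_nonneg)
            hu.ennreal_toReal.aemeasurable
      _ = _ := by
          refine setLIntegral_congr_fun measurableSet_Ioi fun t ht => ?_
          simp only [ENNReal.ofReal_lt_iff_lt_toReal (le_of_lt ht) (hfin _)]
  have hmeas : Measurable fun t : ℝ => volume {x | ENNReal.ofReal t < f x} := by
    refine Antitone.measurable fun s t hst => measure_mono fun x hx => ?_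
    exact (ENNReal.ofReal_le_ofReal hst).trans_lt hx
  -- Capping `h` at `1` makes `layer` applicable and loses nothing, as only levels below `1` matter.
  calc (∫⁻ x, f x) + ∫⁻ x, g x ≤ ∫⁻ x, min (h x) 1 := by
        rw [layer f hf hfle, layer g hg hgle,
          layer (fun x => min (h x) 1) (hh.min measurable_const) fun x => min_le_right _ _,
          ← lintegral_add_left hmeas]
        refine lintegral_mono fun t => ?_
        -- Below level `1` both superlevel sets are nonempty because both suprema are `1`, as
        -- Brunn-Minkowski requires. From level `1` on, those of `f` and `g` are empty.
        rcases lt_or_ge (ENNReal.ofReal t) 1 with ht | ht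
        · obtain ⟨a, ha⟩ := lt_iSup_iff.1 (hf1.symm ▸ ht)
          obtain ⟨b, hb⟩ := lt_iSup_iff.1 (hg1.symm ▸ ht)
          refine volume_add_le_of_measurableSet (measurableSet_lt measurable_const hf)
            (measurableSet_lt measurable_const hg) ⟨a, ha⟩ ⟨b, hb⟩ ?_
          filter_upwards [H] with z hz x hx y hy hxy
          exact lt_min ((lt_min hx hy).trans_le (hz x y hxy)) ht
        · simp [not_lt.2 ((hfle _).trans ht), not_lt.2 ((hgle _).trans ht)]
    _ ≤ ∫⁻ x, h x := lintegral_mono fun x => min_le_left _ _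

/-- The two-term Hölder inequality behind the Borell-Brascamp-Lieb inequality. -/
theorem ENNReal.rpow_add_rpow_le_of_pos {s : ℝ} (hs : 0 < s) (a b F G : ℝ≥0∞) :
    ((a ^ s * F) ^ (1 / (1 + s)) + (b ^ s * G) ^ (1 / (1 + s))) ^ (1 + s) ≤
      (a + b) ^ s * (F + G) := by
  have hs1 : (0 : ℝ) < 1 + s := by linarith
  have hc : (1 + s).HolderConjugate ((1 + s) / s) := by
    rw [Real.holderConjugate_iff]
    refine ⟨by linarith, by field_simp⟩
  have := ENNReal.inner_le_Lp_mul_Lq Finset.univ ![F ^ (1 / (1 + s)), G ^ (1 / (1 + s))]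
    ![a ^ (s / (1 + s)), b ^ (s / (1 + s))] hc
  simp only [Fin.sum_univ_two, Matrix.cons_val_zero, Matrix.cons_val_one, ← ENNReal.rpow_mul] at this
  rw [show 1 / (1 + s) * (1 + s) = 1 by field_simp,
    show s / (1 + s) * ((1 + s) / s) = 1 by field_simp,
    show 1 / ((1 + s) / s) = s / (1 + s) by field_simp] at this
  simp only [ENNReal.rpow_one] at this
  calc _ = (F ^ (1 / (1 + s)) * a ^ (s / (1 + s)) +
        G ^ (1 / (1 + s)) * b ^ (s / (1 + s))) ^ (1 + s) := by
        rw [ENNReal.mul_rpow_of_nonneg _ _ (by positivity),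
          ENNReal.mul_rpow_of_nonneg _ _ (by positivity), ← ENNReal.rpow_mul, ← ENNReal.rpow_mul,
          mul_one_div, mul_comm (F ^ _), mul_comm (G ^ _)]
    _ ≤ ((F + G) ^ (1 / (1 + s)) * (a + b) ^ (s / (1 + s))) ^ (1 + s) := by gcongr
    _ = _ := by
        rw [ENNReal.mul_rpow_of_nonneg _ _ hs1.le, ← ENNReal.rpow_mul, ← ENNReal.rpow_mul,
          show 1 / (1 + s) * (1 + s) = 1 by field_simp, show s / (1 + s) * (1 + s) = s by field_simp,
          ENNReal.rpow_one, mul_comm]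

/-- Dividing `f`, `g` by their suprema `M`, `N` and `h` by `C = (M^(1/s) + N^(1/s))^s` reduces to
the `min` inequality, by homogeneity and monotonicity of the mean. Hölder with `a = M^(1/s)`, `b =
N^(1/s)` undoes the normalisation. -/
theorem borellBrascampLieb_real_of_bounded {s : ℝ} (hs : 0 < s) {f g h : ℝ → ℝ≥0∞}
    (hf : Measurable f) (hg : Measurable g) (hh : Measurable h)
    (hfb : ⨆ x, f x ≠ ∞) (hgb : ⨆ x, g x ≠ ∞)
    (hf0 : ∫⁻ x, f x ≠ 0) (hg0 : ∫⁻ x, g x ≠ 0)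
    (H : ∀ᵐ z : ℝ, ∀ x y, x + y = z → f x ≠ 0 → g y ≠ 0 →
      (f x ^ (1 / s) + g y ^ (1 / s)) ^ s ≤ h z) :
    ((∫⁻ x, f x) ^ (1 / (1 + s)) + (∫⁻ x, g x) ^ (1 / (1 + s))) ^ (1 + s) ≤ ∫⁻ x, h x := by
  have ne_zero : ∀ u : ℝ → ℝ≥0∞, ∫⁻ x, u x ≠ 0 → ⨆ x, u x ≠ 0 := by
    intro u hu h0
    simp only [ENNReal.iSup_eq_zero] at h0
    simp [h0] at hu
  have hs' : 0 < 1 / s := by positivity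
  have hss : 1 / s * s = 1 := by field_simp
  set M := ⨆ x, f x with hM
  set N := ⨆ x, g x with hN
  have hM0 : M ≠ 0 := ne_zero f hf0
  have hN0 : N ≠ 0 := ne_zero g hg0
  have hMs : (M ^ (1 / s)) ^ s = M := by rw [← ENNReal.rpow_mul, hss, ENNReal.rpow_one]
  have hNs : (N ^ (1 / s)) ^ s = N := by rw [← ENNReal.rpow_mul, hss, ENNReal.rpow_one]
  set C := (M ^ (1 / s) + N ^ (1 / s)) ^ s with hC
  have hC0 : C ≠ 0 := by
    simp [hC, ENNReal.rpow_eq_zero_iff, hM0, hs, hs.not_gt, hfb]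
  have hCt : C ≠ ∞ := by
    refine ENNReal.rpow_ne_top_of_nonneg hs.le (ENNReal.add_ne_top.2 ⟨?_, ?_⟩)
    · exact ENNReal.rpow_ne_top_of_nonneg hs'.le hfb
    · exact ENNReal.rpow_ne_top_of_nonneg hs'.le hgb
  have key := lintegral_add_lintegral_le_of_min_le (hf.div_const M) (hg.div_const N)
    (hh.div_const C) (by rw [← ENNReal.iSup_div, ENNReal.div_self hM0 hfb])
    (by rw [← ENNReal.iSup_div, ENNReal.div_self hN0 hgb]) (by
      filter_upwards [H] with z hz x y hxy
      set v := min (f x / M) (g y / N) with hv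
      rcases eq_or_ne v 0 with h0 | h0
      · simp [h0]
      have hfx : v * M ≤ f x := (ENNReal.le_div_iff_mul_le (.inl hM0) (.inl hfb)).1 (min_le_left _ _)
      have hgy : v * N ≤ g y := (ENNReal.le_div_iff_mul_le (.inl hN0) (.inl hgb)).1 (min_le_right _ _)
      have hfx0 : f x ≠ 0 := fun h => mul_ne_zero h0 hM0 (le_zero_iff.1 (h ▸ hfx))
      have hgy0 : g y ≠ 0 := fun h => mul_ne_zero h0 hN0 (le_zero_iff.1 (h ▸ hgy))
      rw [ENNReal.le_div_iff_mul_le (.inl hC0) (.inl hCt)]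
      calc v * C = ((v * M) ^ (1 / s) + (v * N) ^ (1 / s)) ^ s := by
            rw [ENNReal.mul_rpow_of_nonneg _ _ hs'.le, ENNReal.mul_rpow_of_nonneg _ _ hs'.le,
              ← mul_add, ENNReal.mul_rpow_of_nonneg _ _ hs.le, ← ENNReal.rpow_mul, hss,
              ENNReal.rpow_one]
        _ ≤ (f x ^ (1 / s) + g y ^ (1 / s)) ^ s := by gcongr
        _ ≤ h z := hz x y hxy hfx0 hgy0)
  have hint : ∀ (u : ℝ → ℝ≥0∞) (c : ℝ≥0∞), Measurable u → c ≠ 0 → c ≠ ∞ →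
      c * ∫⁻ x, u x / c = ∫⁻ x, u x := by
    intro u c hu hc hc'
    rw [← lintegral_const_mul _ (hu.div_const c)]
    simp only [ENNReal.mul_div_cancel hc hc']
  calc _ = (((M ^ (1 / s)) ^ s * ∫⁻ x, f x / M) ^ (1 / (1 + s)) +
        ((N ^ (1 / s)) ^ s * ∫⁻ x, g x / N) ^ (1 / (1 + s))) ^ (1 + s) := by
        rw [hMs, hNs, hint f M hf hM0 hfb, hint g N hg hN0 hgb]
    _ ≤ C * ((∫⁻ x, f x / M) + ∫⁻ x, g x / N) := ENNReal.rpow_add_rpow_le_of_pos hs _ _ _ _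
    _ ≤ C * ∫⁻ x, h x / C := by gcongr
    _ = ∫⁻ x, h x := hint h C hh hC0 hCt

/-! ### Borell-Brascamp-Lieb in all dimensions -/

/-- The Borell-Brascamp-Lieb inequality on a space of dimension `d`: if
`(f x ^ (1 / s) + g y ^ (1 / s)) ^ s ≤ h (x + y)` whenever `f x` and `g y` do not vanish, then
`(∫ f) ^ (1 / (d + s)) + (∫ g) ^ (1 / (d + s)) ≤ (∫ h) ^ (1 / (d + s))`. -/
def BorellBrascampLieb (V : Type*) [Add V] [MeasureSpace V] (d : ℝ) : Prop :=
  ∀ s : ℝ, 0 < s → ∀ f g h : V → ℝ≥0∞, Measurable f → Measurable g → Measurable h →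
    ∫⁻ x, f x ≠ 0 → ∫⁻ x, g x ≠ 0 →
    (∀ᵐ z : V, ∀ x y, x + y = z → f x ≠ 0 → g y ≠ 0 →
      (f x ^ (1 / s) + g y ^ (1 / s)) ^ s ≤ h z) →
    ((∫⁻ x, f x) ^ (1 / (d + s)) + (∫⁻ x, g x) ^ (1 / (d + s))) ^ (d + s) ≤ ∫⁻ x, h x

/-- Truncating `f` and `g` at height `k` preserves the hypothesis, and monotone convergence recovers
the integrals. -/
theorem borellBrascampLieb_real : BorellBrascampLieb ℝ 1 := by
  intro s hs f g h hf hg hh hf0 hg0 H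
  have trunc : ∀ u : ℝ → ℝ≥0∞, Measurable u →
      Tendsto (fun k : ℕ => ∫⁻ x, min (u x) k) atTop (𝓝 (∫⁻ x, u x)) := by
    intro u hu
    refine lintegral_tendsto_of_tendsto_of_monotone
      (fun k => (hu.min measurable_const).aemeasurable)
      (Eventually.of_forall fun x i j hij => min_le_min le_rfl (by exact_mod_cast hij))
      (Eventually.of_forall fun x => ?_)
    simpa using tendsto_const_nhds.min ENNReal.tendsto_nat_nhds_top
  have hbdd : ∀ (u : ℝ → ℝ≥0∞) (k : ℕ), ⨆ x, min (u x) k ≠ ∞ := fun u k =>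
    ((iSup_le fun x => min_le_right _ _).trans_lt (ENNReal.natCast_lt_top k)).ne
  have hd : (0 : ℝ) < 1 + s := by linarith
  have lim : Tendsto (fun k : ℕ => ((∫⁻ x, min (f x) k) ^ (1 / (1 + s)) +
      (∫⁻ x, min (g x) k) ^ (1 / (1 + s))) ^ (1 + s)) atTop
      (𝓝 (((∫⁻ x, f x) ^ (1 / (1 + s)) + (∫⁻ x, g x) ^ (1 / (1 + s))) ^ (1 + s))) :=
    (ENNReal.continuous_rpow_const.tendsto _).comp
      (((ENNReal.continuous_rpow_const.tendsto _).comp (trunc f hf)).add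
        ((ENNReal.continuous_rpow_const.tendsto _).comp (trunc g hg)))
  refine le_of_tendsto lim ?_
  filter_upwards [(trunc f hf).eventually_ne hf0, (trunc g hg).eventually_ne hg0] with k hfk hgk
  refine borellBrascampLieb_real_of_bounded hs (hf.min measurable_const) (hg.min measurable_const)
    hh (hbdd f k) (hbdd g k) hfk hgk ?_
  filter_upwards [H] with z hz x y hxy hx hy
  refine le_trans ?_ (hz x y hxy (fun h0 => hx (by simp [h0])) (fun h0 => hy (by simp [h0])))
  gcongr <;> exact min_le_left _ _

/-- On slices over `a + b = r` the inequality on `V` with exponent `s` says exactly that the slice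
integrals satisfy the one-dimensional hypothesis with exponent `d + s`. The almost-everywhere form
of the hypothesis passes to almost every slice. -/
theorem BorellBrascampLieb.real_prod {V : Type*} [AddCommGroup V] [MeasureSpace V]
    [SFinite (volume : Measure V)] {d : ℝ} (hd : 0 ≤ d) (hV : BorellBrascampLieb V d) :
    BorellBrascampLieb (ℝ × V) (d + 1) := by
  intro s hs f g h hf hg hh hf0 hg0 H
  rw [Measure.volume_eq_prod] at *
  rw [lintegral_prod _ hf.aemeasurable] at *
  rw [lintegral_prod _ hg.aemeasurable] at *
  rw [lintegral_prod _ hh.aemeasurable]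
  have hds : 0 < d + s := by linarith
  have := borellBrascampLieb_real (d + s) hds (fun r => ∫⁻ v, f (r, v)) (fun r => ∫⁻ v, g (r, v))
    (fun r => ∫⁻ v, h (r, v)) hf.lintegral_prod_right' hg.lintegral_prod_right'
    hh.lintegral_prod_right' hf0 hg0 (by
      filter_upwards [Measure.ae_ae_of_ae_prod H] with r hr a b hab ha hb
      refine hV s hs (fun v => f (a, v)) (fun v => g (b, v)) (fun v => h (r, v))
        (hf.comp measurable_prodMk_left) (hg.comp measurable_prodMk_left)
        (hh.comp measurable_prodMk_left) ha hb ?_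
      filter_upwards [hr] with v hv x y hxy
      exact hv (a, x) (b, y) (by simp [hab, hxy]))
  rwa [← add_assoc, add_comm 1 d] at this

theorem BorellBrascampLieb.of_measurePreserving {V W : Type*} [Add V] [Add W] [MeasureSpace V]
    [MeasureSpace W] {d : ℝ} (hV : BorellBrascampLieb V d) (e : V ≃ᵐ W)
    (he : MeasurePreserving e) (hadd : ∀ x y, e (x + y) = e x + e y) :
    BorellBrascampLieb W d := by
  intro s hs f g h hf hg hh hf0 hg0 H
  rw [← he.lintegral_comp hf] at *
  rw [← he.lintegral_comp hg] at *
  rw [← he.lintegral_comp hh]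
  refine hV s hs _ _ _ (hf.comp e.measurable) (hg.comp e.measurable) (hh.comp e.measurable)
    hf0 hg0 ?_
  filter_upwards [he.quasiMeasurePreserving.ae H] with z hz x y hxy
  exact hz (e x) (e y) (by rw [← hadd, hxy])

theorem borellBrascampLieb_pi (n : ℕ) : BorellBrascampLieb (Fin n → ℝ) n := by
  induction n with
  | zero =>
    intro s hs f g h hf hg hh hf0 hg0 H
    -- The volume of a point space is a Dirac mass, so the conclusion is the hypothesis at `0`.
    simp only [volume_pi, Measure.pi_of_empty _ (0 : Fin 0 → ℝ), lintegral_dirac, ae_dirac_eq] at *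
    simp only [Nat.cast_zero, zero_add]
    exact H 0 0 (by simp) hf0 hg0
  | succ n ih =>
    rw [Nat.cast_succ]
    refine (ih.real_prod n.cast_nonneg).of_measurePreserving
      (MeasurableEquiv.piFinSuccAbove (fun _ => ℝ) 0).symm
      (volume_preserving_piFinSuccAbove (fun _ : Fin (n + 1) => ℝ) 0).symm fun x y => ?_
    ext i
    refine Fin.cases ?_ (fun j => ?_) i <;> simp [MeasurableEquiv.piFinSuccAbove]

theorem borellBrascampLieb_euclideanSpace (n : ℕ) :
    BorellBrascampLieb (EuclideanSpace ℝ (Fin n)) n :=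
  (borellBrascampLieb_pi n).of_measurePreserving (MeasurableEquiv.toLp 2 _)
    (PiLp.volume_preserving_toLp (Fin n)) fun _ _ => rfl

/-! ### Dilations and elementary bounds for the sum -/

theorem lintegral_comp_inv_smul {n : ℕ} {c : ℝ} (hc : 0 < c)
    (u : EuclideanSpace ℝ (Fin n) → ℝ≥0∞) :
    ∫⁻ x, u (c⁻¹ • x) = ENNReal.ofReal (c ^ n) * ∫⁻ x, u x := by
  have hc' : c⁻¹ ≠ 0 := (inv_pos.2 hc).ne'
  have h := (Homeomorph.smulOfNeZero c⁻¹ hc').toMeasurableEquiv.measurableEmbedding.lintegral_map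
    (μ := volume) u
  have hm : Measure.map (Homeomorph.smulOfNeZero c⁻¹ hc').toMeasurableEquiv
      (volume : Measure (EuclideanSpace ℝ (Fin n))) = ENNReal.ofReal (c ^ n) • volume := by
    have := Measure.map_addHaar_smul (volume : Measure (EuclideanSpace ℝ (Fin n))) hc'
    rw [finrank_euclideanSpace_fin, inv_pow, inv_inv, abs_of_pos (by positivity)] at this
    exact this
  rw [hm, lintegral_smul_measure] at h
  exact h.symm

theorem rpow_neg_one_div_eq_inv {a : ℝ} (ha : 0 < a) (p : ℝ) :
    a ^ (-(1 / p)) = (a ^ (1 / p))⁻¹ := Real.rpow_neg ha.le _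

theorem mem_tsupport_lpScale {n : ℕ} {p s a : ℝ} (ha : 0 < a) (f : EuclideanSpace ℝ (Fin n) → ℝ)
    (x : EuclideanSpace ℝ (Fin n)) :
    x ∈ tsupport (lpScale p s a f) ↔ a ^ (-(1 / p)) • x ∈ tsupport f := by
  have hc : a ^ (-(1 / p)) ≠ 0 := (Real.rpow_pos_of_pos ha _).ne'
  have hsupp : Function.support (lpScale p s a f) =
      Homeomorph.smulOfNeZero (α := EuclideanSpace ℝ (Fin n)) _ hc ⁻¹' Function.support f := by
    ext x
    simp [lpScale, (Real.rpow_pos_of_pos ha (s / p)).ne']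
  rw [tsupport, hsupp, ← Homeomorph.preimage_closure]
  rfl

theorem tsupport_lpScale_nonempty {n : ℕ} {p s a : ℝ} (ha : 0 < a)
    {f : EuclideanSpace ℝ (Fin n) → ℝ} (hf : (tsupport f).Nonempty) :
    (tsupport (lpScale p s a f)).Nonempty := by
  obtain ⟨x, hx⟩ := hf
  have hc : a ^ (-(1 / p)) ≠ 0 := (Real.rpow_pos_of_pos ha _).ne'
  exact ⟨(a ^ (-(1 / p)))⁻¹ • x, by rwa [mem_tsupport_lpScale ha, smul_inv_smul₀ hc]⟩

theorem lpScale_nonneg {n : ℕ} {p s a : ℝ} (ha : 0 < a) {f : EuclideanSpace ℝ (Fin n) → ℝ}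
    (hf : ∀ x, 0 ≤ f x) (x : EuclideanSpace ℝ (Fin n)) : 0 ≤ lpScale p s a f x :=
  mul_nonneg (Real.rpow_nonneg ha.le _) (hf _)

theorem lintegral_lpScale {n : ℕ} {p s a : ℝ} (ha : 0 < a) (f : EuclideanSpace ℝ (Fin n) → ℝ) :
    ∫⁻ x, ENNReal.ofReal (lpScale p s a f x) =
      ENNReal.ofReal (a ^ ((n + s) / p)) * ∫⁻ x, ENNReal.ofReal (f x) := by
  have hc : 0 < a ^ (1 / p) := Real.rpow_pos_of_pos ha _
  simp only [lpScale, ENNReal.ofReal_mul (Real.rpow_nonneg ha.le (s / p)),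
    rpow_neg_one_div_eq_inv ha]
  rw [lintegral_const_mul' _ _ ENNReal.ofReal_ne_top,
    lintegral_comp_inv_smul hc fun x => ENNReal.ofReal (f x), ← mul_assoc,
    ← ENNReal.ofReal_mul (Real.rpow_nonneg ha.le _), ← Real.rpow_natCast, ← Real.rpow_mul ha.le,
    ← Real.rpow_add ha]
  congr 3
  ring

theorem lpSum_comm {n : ℕ} (p s : ℝ) (f g : EuclideanSpace ℝ (Fin n) → ℝ) :
    lpSum p s f g = lpSum p s g f := by
  have key : ∀ f g : EuclideanSpace ℝ (Fin n) → ℝ, ∀ z, lpSum p s f g z ≤ lpSum p s g f z := by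
    rintro f g z
    refine sSup_le_sSup ?_
    rintro v ⟨x, hx, y, hy, t, ht, hz, hv⟩
    refine ⟨y, hy, x, hx, 1 - t, ⟨by linarith [ht.2], by linarith [ht.1]⟩, ?_, ?_⟩
    · rw [sub_sub_cancel, add_comm, hz]
    · rw [sub_sub_cancel, add_comm, hv]
  exact funext fun z => le_antisymm (key f g z) (key g f z)

theorem le_lpSum {n : ℕ} {p s : ℝ} {f g : EuclideanSpace ℝ (Fin n) → ℝ}
    {x y : EuclideanSpace ℝ (Fin n)} (hx : x ∈ tsupport f) (hy : y ∈ tsupport g) {t : ℝ}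
    (ht : t ∈ Icc (0 : ℝ) 1) :
    ENNReal.ofReal
      (((1 - t) ^ (1 - 1 / p) * f x ^ (1 / s) + t ^ (1 - 1 / p) * g y ^ (1 / s)) ^ s) ≤
    lpSum p s f g ((1 - t) ^ (1 - 1 / p) • x + t ^ (1 - 1 / p) • y) :=
  le_sSup ⟨x, hx, y, hy, t, ht, rfl, rfl⟩

/-- Take `t = 0` and a fixed `y` in the support of `g`. The weight of `y` is `0^(1 - 1/p)`, which is
`1` when `p = 1`; hence the translation. -/
theorem lintegral_le_lintegral_lpSum_left {n : ℕ} {p s : ℝ} (hs : 0 < s)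
    {f g : EuclideanSpace ℝ (Fin n) → ℝ} (hf : ∀ x, 0 ≤ f x) (hg : ∀ x, 0 ≤ g x)
    (hgs : (tsupport g).Nonempty) :
    ∫⁻ x, ENNReal.ofReal (f x) ≤ ∫⁻ x, lpSum p s f g x := by
  obtain ⟨y, hy⟩ := hgs
  rw [← lintegral_add_right_eq_self (lpSum p s f g) ((0 : ℝ) ^ (1 - 1 / p) • y)]
  refine lintegral_mono fun x => ?_
  by_cases hx : x ∈ tsupport f
  · have h := le_lpSum (p := p) (s := s) hx hy (t := 0) (by simp)
    simp only [sub_zero, Real.one_rpow, one_smul, one_mul] at h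
    refine le_trans (ENNReal.ofReal_le_ofReal ?_) h
    calc f x = (f x ^ (1 / s)) ^ s := by
          rw [← Real.rpow_mul (hf x), one_div_mul_cancel hs.ne', Real.rpow_one]
      _ ≤ _ := by
          have := Real.rpow_nonneg (hf x) (1 / s)
          gcongr
          exact le_add_of_nonneg_right (mul_nonneg (Real.rpow_nonneg le_rfl _)
            (Real.rpow_nonneg (hg y) _))
  · simp [image_eq_zero_of_notMem_tsupport hx]

theorem lintegral_le_lintegral_lpSum_right {n : ℕ} {p s : ℝ} (hs : 0 < s)
    {f g : EuclideanSpace ℝ (Fin n) → ℝ} (hf : ∀ x, 0 ≤ f x) (hg : ∀ x, 0 ≤ g x)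
    (hfs : (tsupport f).Nonempty) :
    ∫⁻ x, ENNReal.ofReal (g x) ≤ ∫⁻ x, lpSum p s f g x :=
  lpSum_comm p s f g ▸ lintegral_le_lintegral_lpSum_left hs hg hf hfs

/-! ### The integral inequality for the sum -/

theorem mul_add_mul_rpow_le_lintegral_lpSum {n : ℕ} {p s : ℝ} (hs : 0 < s)
    {f g : EuclideanSpace ℝ (Fin n) → ℝ} (hf : ∀ x, 0 ≤ f x) (hg : ∀ x, 0 ≤ g x)
    (hf0 : ∫⁻ x, ENNReal.ofReal (f x) ≠ 0) (hg0 : ∫⁻ x, ENNReal.ofReal (g x) ≠ 0)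
    (hm : AEMeasurable (lpSum p s f g) volume) {t : ℝ} (ht : t ∈ Ioo (0 : ℝ) 1) :
    (ENNReal.ofReal ((1 - t) ^ (1 - 1 / p)) * (∫⁻ x, ENNReal.ofReal (f x)) ^ (1 / (n + s)) +
      ENNReal.ofReal (t ^ (1 - 1 / p)) * (∫⁻ x, ENNReal.ofReal (g x)) ^ (1 / (n + s))) ^ (n + s) ≤
    ∫⁻ x, lpSum p s f g x := by
  have hα : 0 < (1 - t) ^ (1 - 1 / p) := Real.rpow_pos_of_pos (by linarith [ht.2]) _
  have hβ : 0 < t ^ (1 - 1 / p) := Real.rpow_pos_of_pos ht.1 _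
  have hle := @le_lpSum n p s f g
  set α := (1 - t) ^ (1 - 1 / p) with hαdef
  set β := t ^ (1 - 1 / p) with hβdef
  have hns : 0 < n + s := by positivity
  -- Measurable minorants with the same integrals stand in for `f` and `g`, and where they are
  -- nonzero so are `f` and `g`.
  obtain ⟨u, hu, huf, huI⟩ := exists_measurable_le_lintegral_eq volume fun x => ENNReal.ofReal (f x)
  obtain ⟨v, hv, hvg, hvI⟩ := exists_measurable_le_lintegral_eq volume fun x => ENNReal.ofReal (g x)
  have hI : ∀ {c : ℝ}, 0 < c → ∀ w : EuclideanSpace ℝ (Fin n) → ℝ≥0∞,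
      ∫⁻ x, ENNReal.ofReal (c ^ s) * w (c⁻¹ • x) =
        ENNReal.ofReal c ^ (n + s) * ∫⁻ x, w x := by
    intro c hc w
    rw [lintegral_const_mul' _ _ ENNReal.ofReal_ne_top, lintegral_comp_inv_smul hc, ← mul_assoc,
      ← ENNReal.ofReal_mul (by positivity), ← Real.rpow_natCast, ← Real.rpow_add hc,
      ENNReal.ofReal_rpow_of_pos hc, add_comm]
  have hpow : ∀ {c : ℝ}, 0 < c → ∀ F : ℝ≥0∞,
      (ENNReal.ofReal c ^ (n + s) * F) ^ (1 / (n + s)) =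
        ENNReal.ofReal c * F ^ (1 / (n + s)) := by
    intro c hc F
    rw [ENNReal.mul_rpow_of_nonneg _ _ (by positivity), ← ENNReal.rpow_mul,
      mul_one_div_cancel hns.ne', ENNReal.rpow_one]
  have hval : ∀ {c r : ℝ}, 0 < c → 0 ≤ r →
      (ENNReal.ofReal (c ^ s) * ENNReal.ofReal r) ^ (1 / s) = ENNReal.ofReal (c * r ^ (1 / s)) := by
    intro c r hc hr
    rw [← ENNReal.ofReal_mul (by positivity), ENNReal.ofReal_rpow_of_nonneg (by positivity)
      (by positivity), Real.mul_rpow (by positivity) hr, ← Real.rpow_mul hc.le,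
      mul_one_div_cancel hs.ne', Real.rpow_one]
  have hne : ∀ {c : ℝ}, 0 < c → ENNReal.ofReal c ^ (n + s) ≠ 0 := fun hc => by
    rw [ENNReal.ofReal_rpow_of_pos hc]
    simpa using Real.rpow_pos_of_pos hc _
  have key := borellBrascampLieb_euclideanSpace n s hs
    (fun x => ENNReal.ofReal (α ^ s) * u (α⁻¹ • x)) (fun x => ENNReal.ofReal (β ^ s) * v (β⁻¹ • x))
    (hm.mk _) ((hu.comp (measurable_const_smul _)).const_mul _)
    ((hv.comp (measurable_const_smul _)).const_mul _) hm.measurable_mk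
    (by rw [hI hα, ← huI]; exact mul_ne_zero (hne hα) hf0)
    (by rw [hI hβ, ← hvI]; exact mul_ne_zero (hne hβ) hg0) (by
      -- The sum agrees with its measurable representative only almost everywhere, which is why the
      -- hypothesis is needed only for almost every `z`.
      filter_upwards [hm.ae_eq_mk] with z hz x y hxy hx hy
      rw [← hz]
      have hux := huf (α⁻¹ • x)
      have hvy := hvg (β⁻¹ • y)
      have hfx : f (α⁻¹ • x) ≠ 0 := fun h0 => right_ne_zero_of_mul hx (by simpa [h0] using hux)
      have hgy : g (β⁻¹ • y) ≠ 0 := fun h0 => right_ne_zero_of_mul hy (by simpa [h0] using hvy)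
      have h := hle (subset_tsupport f hfx) (subset_tsupport g hgy) (t := t) ⟨ht.1.le, ht.2.le⟩
      rw [← hαdef, ← hβdef, smul_inv_smul₀ hα.ne', smul_inv_smul₀ hβ.ne', hxy] at h
      refine le_trans ?_ h
      have h1 := Real.rpow_nonneg (hf (α⁻¹ • x)) (1 / s)
      have h2 := Real.rpow_nonneg (hg (β⁻¹ • y)) (1 / s)
      have h3 : 0 ≤ α * f (α⁻¹ • x) ^ (1 / s) + β * g (β⁻¹ • y) ^ (1 / s) := by positivity
      rw [← ENNReal.ofReal_rpow_of_nonneg h3 hs.le, ENNReal.ofReal_add (by positivity)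
          (by positivity), ← hval hα (hf _), ← hval hβ (hg _)]
      gcongr)
  rw [hI hα, hI hβ, hpow hα, hpow hβ, ← lintegral_congr_ae hm.ae_eq_mk, ← huI, ← hvI] at key
  exact key

/-- The weights that turn the Brunn-Minkowski sum into the `L_p` sum. -/
theorem exists_rpow_mul_add_rpow_mul_eq {p A B : ℝ} (hp : 1 ≤ p) (hA : 0 < A) (hB : 0 < B) :
    ∃ t ∈ Ioo (0 : ℝ) 1, (1 - t) ^ (1 - 1 / p) * A + t ^ (1 - 1 / p) * B =
      (A ^ p + B ^ p) ^ (1 / p) := by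
  have hp0 : 0 < p := by linarith
  have hAp := Real.rpow_pos_of_pos hA p
  have hBp := Real.rpow_pos_of_pos hB p
  set D := A ^ p + B ^ p with hD
  have hD0 : 0 < D := by positivity
  have hw : ∀ {X : ℝ}, 0 < X → (X ^ p / D) ^ (1 - 1 / p) * X = X ^ p / D ^ (1 - 1 / p) := by
    intro X hX
    rw [Real.div_rpow (Real.rpow_nonneg hX.le _) hD0.le, ← Real.rpow_mul hX.le, div_mul_eq_mul_div]
    congr 1
    nth_rewrite 2 [← Real.rpow_one X]
    rw [← Real.rpow_add hX]
    congr 1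
    field_simp
    ring
  -- The equality case of Hölder for the vectors `(A, B)` and `((1 - t)^(1/q), t^(1/q))`.
  refine ⟨B ^ p / D, ⟨by positivity, (div_lt_one hD0).2 (by linarith)⟩, ?_⟩
  rw [show 1 - B ^ p / D = A ^ p / D by field_simp; linarith, hw hA, hw hB, ← add_div, ← hD]
  nth_rewrite 1 [← Real.rpow_one D]
  rw [← Real.rpow_sub hD0, sub_sub_cancel]

theorem rpow_add_rpow_le_lintegral_lpSum {n : ℕ} {p s F G : ℝ} (hp : 1 ≤ p) (hs : 0 < s)
    {f g : EuclideanSpace ℝ (Fin n) → ℝ} (hf : ∀ x, 0 ≤ f x) (hg : ∀ x, 0 ≤ g x)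
    (hF : ∫⁻ x, ENNReal.ofReal (f x) = ENNReal.ofReal F)
    (hG : ∫⁻ x, ENNReal.ofReal (g x) = ENNReal.ofReal G) (hF0 : 0 < F) (hG0 : 0 < G)
    (hm : AEMeasurable (lpSum p s f g) volume) :
    ENNReal.ofReal ((F ^ (p / (n + s)) + G ^ (p / (n + s))) ^ ((n + s) / p)) ≤
      ∫⁻ x, lpSum p s f g x := by
  have hp0 : 0 < p := by linarith
  have hns : 0 < n + s := by positivity
  have hA := Real.rpow_pos_of_pos hF0 (1 / (n + s))
  have hB := Real.rpow_pos_of_pos hG0 (1 / (n + s))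
  obtain ⟨t, ht, htD⟩ := exists_rpow_mul_add_rpow_mul_eq hp hA hB
  have key := mul_add_mul_rpow_le_lintegral_lpSum hs hf hg (by simpa [hF] using hF0)
    (by simpa [hG] using hG0) hm ht
  have hα := Real.rpow_nonneg (sub_nonneg.2 ht.2.le) (1 - 1 / p)
  have hβ := Real.rpow_nonneg ht.1.le (1 - 1 / p)
  rw [hF, hG, ENNReal.ofReal_rpow_of_pos hF0, ENNReal.ofReal_rpow_of_pos hG0,
    ← ENNReal.ofReal_mul hα, ← ENNReal.ofReal_mul hβ, ← ENNReal.ofReal_add (by positivity)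
    (by positivity), ENNReal.ofReal_rpow_of_nonneg (by positivity) hns.le, htD,
    ← Real.rpow_mul hF0.le, ← Real.rpow_mul hG0.le, ← Real.rpow_mul (by positivity),
    one_div_mul_eq_div, one_div_mul_eq_div] at key
  exact key

/-! ### The first variation inequality -/

theorem tendsto_rpow_slope {P Q r : ℝ} (hP : 0 < P) :
    Tendsto (fun ε : ℝ => ((P + ε * Q) ^ r - P ^ r) / ε) (𝓝[>] 0) (𝓝 (Q * r * P ^ (r - 1))) := by
  have h1 : HasDerivAt (fun ε : ℝ => P + ε * Q) Q 0 := by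
    simpa using ((hasDerivAt_id (0 : ℝ)).mul_const Q).const_add P
  have h2 := h1.rpow_const (p := r) (Or.inl (by simpa using hP.ne'))
  have h3 := h2.tendsto_slope_zero_right
  simp only [zero_add, zero_mul, add_zero, smul_eq_mul] at h3
  exact h3.congr fun ε => by rw [inv_mul_eq_div]

theorem integral_le_toReal_lintegral_lpSum {n : ℕ} {p s : ℝ} (hs : 0 < s)
    {f g : EuclideanSpace ℝ (Fin n) → ℝ} (hf : ∀ x, 0 ≤ f x) (hg : ∀ x, 0 ≤ g x)
    (hfi : Integrable f volume) (hgs : (tsupport g).Nonempty)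
    (hfin : ∫⁻ z, lpSum p s f g z ≠ ∞) :
    ∫ x, f x ≤ (∫⁻ z, lpSum p s f g z).toReal := by
  rw [← ENNReal.ofReal_le_iff_le_toReal hfin,
    ofReal_integral_eq_lintegral_ofReal hfi (Eventually.of_forall hf)]
  exact lintegral_le_lintegral_lpSum_left hs hf hg hgs

/-- Adding a dilate of `g` never decreases the integral. This settles the cases where the right-hand
side of (i) is `0`. -/
theorem HasFirstVariation.nonneg {n : ℕ} {p s : ℝ} (hp : 1 ≤ p) (hs : 0 < s)
    {f g : EuclideanSpace ℝ (Fin n) → ℝ} (hf : ∀ x, 0 ≤ f x) (hg : ∀ x, 0 ≤ g x)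
    (hfi : Integrable f volume) (hgs : (tsupport g).Nonempty) {S : ℝ}
    (h : HasFirstVariation p s f g S) : 0 ≤ S := by
  obtain ⟨hev, L, hL, rfl⟩ := h
  have : 0 ≤ L := by
    refine ge_of_tendsto hL ?_
    filter_upwards [hev, self_mem_nhdsWithin] with ε hε hε0
    have := integral_le_toReal_lintegral_lpSum hs hf (lpScale_nonneg hε0 hg) hfi
      (tsupport_lpScale_nonempty hε0 hgs) hε.2
    exact div_nonneg (sub_nonneg.2 this) (le_of_lt hε0)
  positivity

theorem lintegral_lpScale_eq_ofReal {n : ℕ} {p s a : ℝ} (ha : 0 < a)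
    {g : EuclideanSpace ℝ (Fin n) → ℝ} (hg : ∀ x, 0 ≤ g x) (hgi : Integrable g volume) :
    ∫⁻ x, ENNReal.ofReal (lpScale p s a g x) =
      ENNReal.ofReal (a ^ ((n + s) / p) * ∫ x, g x) := by
  rw [lintegral_lpScale ha, ENNReal.ofReal_mul (Real.rpow_nonneg ha.le _),
    ofReal_integral_eq_lintegral_ofReal hgi (Eventually.of_forall hg)]

/-- The power rule is unavailable at `∫ f = 0`. Instead the sum is bounded below by `ε ×_{p,s} g`
alone, whose integral is `ε * ∫ g` since `(n + s) / p = 1`. -/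
theorem HasFirstVariation.integral_le_of_integral_eq_zero {n : ℕ} {p s : ℝ} (hs : 0 < s)
    (hpn : p = n + s) {f g : EuclideanSpace ℝ (Fin n) → ℝ} (hf : ∀ x, 0 ≤ f x)
    (hg : ∀ x, 0 ≤ g x) (hgi : Integrable g volume) (hfs : (tsupport f).Nonempty)
    (hF : ∫ x, f x = 0) {S : ℝ} (h : HasFirstVariation p s f g S) : ∫ x, g x ≤ S := by
  have hns : 0 < n + s := by positivity
  obtain ⟨hev, L, hL, rfl⟩ := h
  have h1 : p / (n + s) = 1 := by rw [hpn, div_self hns.ne']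
  have h2 : (n + s) / p = 1 := by rw [hpn, div_self hns.ne']
  rw [h1, one_mul]
  refine ge_of_tendsto hL ?_
  filter_upwards [hev, self_mem_nhdsWithin] with ε hε hε0
  have hle := lintegral_le_lintegral_lpSum_right (p := p) hs hf
    (lpScale_nonneg (p := p) (s := s) hε0 hg) hfs
  rw [lintegral_lpScale_eq_ofReal hε0 hg hgi, ENNReal.ofReal_le_iff_le_toReal hε.2, h2,
    Real.rpow_one] at hle
  rw [hF, sub_zero, le_div_iff₀ hε0, mul_comm]
  exact hle

theorem HasFirstVariation.rpow_mul_rpow_le {n : ℕ} {p s : ℝ} (hp : 1 ≤ p) (hs : 0 < s)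
    {f g : EuclideanSpace ℝ (Fin n) → ℝ} (hf : ∀ x, 0 ≤ f x) (hg : ∀ x, 0 ≤ g x)
    (hfi : Integrable f volume) (hgi : Integrable g volume) (hF : 0 < ∫ x, f x)
    (hG : 0 < ∫ x, g x) {S : ℝ} (h : HasFirstVariation p s f g S) :
    (∫ x, f x) ^ (1 - p / (n + s)) * (∫ x, g x) ^ (p / (n + s)) ≤ S := by
  have hp0 : 0 < p := by linarith
  have hns : 0 < n + s := by positivity
  obtain ⟨hev, L, hL, rfl⟩ := h
  set F := ∫ x, f x with hFdef
  set G := ∫ x, g x with hGdef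
  have hinv : p / (n + s) * ((n + s) / p) = 1 := by field_simp
  have hinv' : (n + s) / p * (p / (n + s)) = 1 := by field_simp
  have hpow : ∀ {X : ℝ}, 0 < X → (X ^ (p / (n + s))) ^ ((n + s) / p) = X := by
    intro X hX
    rw [← Real.rpow_mul hX.le, hinv, Real.rpow_one]
  have hP : 0 < F ^ (p / (n + s)) := Real.rpow_pos_of_pos hF _
  -- The difference quotient of the lower bound, with `P = F^κ` and `Q = G^κ` for `κ = p/(n+s)`.
  have hlim := tendsto_rpow_slope (Q := G ^ (p / (n + s))) (r := (n + s) / p) hP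
  have hle := le_of_tendsto_of_tendsto hlim hL (by
    filter_upwards [hev, self_mem_nhdsWithin] with ε hε hε0
    have hε0' : 0 < ε := hε0
    have key := rpow_add_rpow_le_lintegral_lpSum hp hs hf
      (lpScale_nonneg (p := p) (s := s) hε0' hg)
      (ofReal_integral_eq_lintegral_ofReal hfi (Eventually.of_forall hf)).symm
      (lintegral_lpScale_eq_ofReal hε0' hg hgi) hF (by positivity) hε.1
    rw [Real.mul_rpow (by positivity) hG.le, ← Real.rpow_mul hε0'.le, hinv', Real.rpow_one,
      ENNReal.ofReal_le_iff_le_toReal hε.2] at key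
    rw [hpow hF]
    gcongr)
  calc F ^ (1 - p / (n + s)) * G ^ (p / (n + s))
      = p / (n + s) * (G ^ (p / (n + s)) * ((n + s) / p) *
        (F ^ (p / (n + s))) ^ ((n + s) / p - 1)) := by
        rw [← Real.rpow_mul hF.le, mul_sub, hinv, mul_one]
        field_simp
    _ ≤ p / (n + s) * L := by gcongr

/-! ### Equality for dilates of an `s`-concave function -/

theorem IsSConcave.concaveOn {n : ℕ} {s : ℝ} (hs : 0 < s) {g : EuclideanSpace ℝ (Fin n) → ℝ}
    (hg : IsSConcave s g) : ConcaveOn ℝ (tsupport g) fun x => g x ^ (1 / s) := by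
  obtain ⟨hg0, -, -, hconv, hc⟩ := hg
  refine ⟨hconv, fun x hx y hy a b ha hb hab => ?_⟩
  have h := hc x hx y hy a ⟨ha, by linarith⟩
  rw [show 1 - a = b by linarith] at h
  have h1 := Real.rpow_nonneg (hg0 x) (1 / s)
  have h2 := Real.rpow_nonneg (hg0 y) (1 / s)
  simp only [smul_eq_mul]
  rwa [one_div s, Real.le_rpow_inv_iff_of_pos (by rw [← one_div]; positivity) (hg0 _) hs, ← one_div]

/-- Hölder, obtained by applying weighted AM-GM to each term after division by `(a + b)^(1/p)`. It
bounds the dilation factor in the sum of two dilates. -/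
theorem rpow_mul_rpow_add_le {p a b t : ℝ} (hp : 1 ≤ p) (ha : 0 < a) (hb : 0 < b)
    (ht : t ∈ Icc (0 : ℝ) 1) :
    (1 - t) ^ (1 - 1 / p) * a ^ (1 / p) + t ^ (1 - 1 / p) * b ^ (1 / p) ≤ (a + b) ^ (1 / p) := by
  have hp0 : 0 < p := by linarith
  have hab : 0 < a + b := by positivity
  have hp1 : 0 ≤ 1 - 1 / p := sub_nonneg.2 ((div_le_one hp0).2 hp)
  have h1 := Real.geom_mean_le_arith_mean2_weighted hp1 (one_div_pos.2 hp0).le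
    (sub_nonneg.2 ht.2) (div_pos ha hab).le (sub_add_cancel _ _)
  have h2 := Real.geom_mean_le_arith_mean2_weighted hp1 (one_div_pos.2 hp0).le
    ht.1 (div_pos hb hab).le (sub_add_cancel _ _)
  rw [Real.div_rpow ha.le hab.le, ← mul_div_assoc] at h1
  rw [Real.div_rpow hb.le hab.le, ← mul_div_assoc] at h2
  have hsum : (1 - 1 / p) * (1 - t) + 1 / p * (a / (a + b)) +
      ((1 - 1 / p) * t + 1 / p * (b / (a + b))) = 1 := by
    field_simp
    ring
  rw [← div_le_one (Real.rpow_pos_of_pos hab _), add_div]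
  linarith

theorem lpScale_rpow_one_div {n : ℕ} {p s a : ℝ} (hs : 0 < s) (ha : 0 < a)
    {g : EuclideanSpace ℝ (Fin n) → ℝ} (hg : ∀ x, 0 ≤ g x) (x : EuclideanSpace ℝ (Fin n)) :
    lpScale p s a g x ^ (1 / s) = a ^ (1 / p) * g (a ^ (-(1 / p)) • x) ^ (1 / s) := by
  rw [lpScale, Real.mul_rpow (Real.rpow_nonneg ha.le _) (hg _), ← Real.rpow_mul ha.le]
  congr 2
  field_simp

theorem lpScale_eq_mul_rpow {n : ℕ} {p s a : ℝ} (hs : 0 < s) (ha : 0 < a)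
    {g : EuclideanSpace ℝ (Fin n) → ℝ} (hg : ∀ x, 0 ≤ g x) (x : EuclideanSpace ℝ (Fin n)) :
    lpScale p s a g x = (a ^ (1 / p) * g ((a ^ (1 / p))⁻¹ • x) ^ (1 / s)) ^ s := by
  rw [← rpow_neg_one_div_eq_inv ha, ← lpScale_rpow_one_div hs ha hg, one_div,
    Real.rpow_inv_rpow (lpScale_nonneg ha hg x) hs.ne']

/-- Dilates of an `s`-concave function whose support contains the origin add up. -/
theorem IsSConcave.lpSum_lpScale_lpScale {n : ℕ} {p s a b : ℝ} (hp : 1 ≤ p) (hs : 0 < s)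
    (ha : 0 < a) (hb : 0 < b) {g : EuclideanSpace ℝ (Fin n) → ℝ} (hg : IsSConcave s g)
    (h0 : 0 ∈ tsupport g) (z : EuclideanSpace ℝ (Fin n)) :
    lpSum p s (lpScale p s a g) (lpScale p s b g) z =
      ENNReal.ofReal (lpScale p s (a + b) g z) := by
  have hg0 := hg.1
  have hconc := hg.concaveOn hs
  have hab : 0 < a + b := by positivity
  have hA : 0 < a ^ (1 / p) := Real.rpow_pos_of_pos ha _
  have hB : 0 < b ^ (1 / p) := Real.rpow_pos_of_pos hb _
  have hC : 0 < (a + b) ^ (1 / p) := Real.rpow_pos_of_pos hab _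
  have hφ : ∀ x, 0 ≤ g x ^ (1 / s) := fun x => Real.rpow_nonneg (hg0 x) _
  rw [lpScale_eq_mul_rpow hs hab hg0]
  refine le_antisymm (sSup_le ?_) ?_
  · rintro v ⟨x, hx, y, hy, t, ht, hz, rfl⟩
    rw [mem_tsupport_lpScale ha] at hx
    rw [mem_tsupport_lpScale hb] at hy
    rw [lpScale_rpow_one_div hs ha hg0, lpScale_rpow_one_div hs hb hg0]
    rw [rpow_neg_one_div_eq_inv ha] at *
    rw [rpow_neg_one_div_eq_inv hb] at *
    have hle := rpow_mul_rpow_add_le hp ha hb ht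
    have hα0 := Real.rpow_nonneg (sub_nonneg.2 ht.2) (1 - 1 / p)
    have hβ0 := Real.rpow_nonneg ht.1 (1 - 1 / p)
    have hpos : 0 < (1 - t) ^ (1 - 1 / p) * a ^ (1 / p) + t ^ (1 - 1 / p) * b ^ (1 / p) := by
      rcases eq_or_lt_of_le ht.1 with h | h
      -- At `t = 0` the first weight is `1`; for `t > 0` the second one is positive.
      · rw [← h, sub_zero, Real.one_rpow, one_mul]
        have := Real.rpow_nonneg (le_refl (0 : ℝ)) (1 - 1 / p)
        positivity
      · have := Real.rpow_pos_of_pos h (1 - 1 / p)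
        positivity
    set A := a ^ (1 / p)
    set B := b ^ (1 / p)
    set C := (a + b) ^ (1 / p)
    set c := (1 - t) ^ (1 - 1 / p)
    set d := t ^ (1 - 1 / p)
    obtain ⟨u, rfl⟩ : ∃ u, x = A • u := ⟨A⁻¹ • x, (smul_inv_smul₀ hA.ne' x).symm⟩
    obtain ⟨w, rfl⟩ : ∃ w, y = B • w := ⟨B⁻¹ • y, (smul_inv_smul₀ hB.ne' y).symm⟩
    rw [inv_smul_smul₀ hA.ne'] at *
    rw [inv_smul_smul₀ hB.ne'] at *
    set r := c * A + d * B with hr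
    have hw1 : 0 ≤ c * A / r := by positivity
    have hw2 : 0 ≤ d * B / r := by positivity
    have hw : c * A / r + d * B / r = 1 := by rw [← add_div, div_self hpos.ne']
    -- Here `z` is `r` times a convex combination of `u` and `w`. As `r ≤ C`, the point `C⁻¹ • z`
    -- lies between that combination and the origin, so concavity applies a second time; the value
    -- at the origin is dropped as nonnegative.
    have h1 := hconc.2 hx hy hw1 hw2 hw
    have h2 := hconc.2 (hconc.1 hx hy hw1 hw2 hw) h0 (by positivity : 0 ≤ r / C)
      (sub_nonneg.2 ((div_le_one hC).2 hle)) (by ring)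
    have hzC : (r / C) • ((c * A / r) • u + (d * B / r) • w) + (1 - r / C) •
        (0 : EuclideanSpace ℝ (Fin n)) = C⁻¹ • z := by
      rw [hz, smul_zero, add_zero, smul_add, smul_add, smul_smul, smul_smul, smul_smul, smul_smul,
        smul_smul, smul_smul]
      congr 2 <;> field_simp
    rw [hzC] at h2
    simp only [smul_eq_mul] at h1 h2
    have hu := hφ u
    have hw' := hφ w
    refine ENNReal.ofReal_le_ofReal (Real.rpow_le_rpow (by positivity) ?_ hs.le)
    calc c * (A * g u ^ (1 / s)) + d * (B * g w ^ (1 / s))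
        = r * (c * A / r * g u ^ (1 / s) + d * B / r * g w ^ (1 / s)) := by field_simp
      _ ≤ r * g ((c * A / r) • u + (d * B / r) • w) ^ (1 / s) := by gcongr
      _ = C * (r / C * g ((c * A / r) • u + (d * B / r) • w) ^ (1 / s)) := by field_simp
      _ ≤ C * g (C⁻¹ • z) ^ (1 / s) := by
        gcongr
        exact (le_add_of_nonneg_right (mul_nonneg (sub_nonneg.2 ((div_le_one hC).2 hle))
          (hφ 0))).trans h2
  · by_cases hzT : ((a + b) ^ (1 / p))⁻¹ • z ∈ tsupport g
    -- Writing `z = (a + b)^(1/p) • u`, dilates of the same `u` attain the value at the optimal `t`,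
    -- where the weighted factors add up to `(a + b)^(1/p)`.
    · obtain ⟨t, ht, htD⟩ := exists_rpow_mul_add_rpow_mul_eq hp hA hB
      have hp0 : p ≠ 0 := by linarith
      rw [← Real.rpow_mul ha.le, ← Real.rpow_mul hb.le, one_div_mul_cancel hp0, Real.rpow_one,
        Real.rpow_one] at htD
      obtain ⟨u, rfl⟩ : ∃ u, z = (a + b) ^ (1 / p) • u := ⟨_, (smul_inv_smul₀ hC.ne' z).symm⟩
      rw [inv_smul_smul₀ hC.ne'] at *
      have hx : a ^ (1 / p) • u ∈ tsupport (lpScale p s a g) := by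
        rwa [mem_tsupport_lpScale ha, rpow_neg_one_div_eq_inv ha, inv_smul_smul₀ hA.ne']
      have hy : b ^ (1 / p) • u ∈ tsupport (lpScale p s b g) := by
        rwa [mem_tsupport_lpScale hb, rpow_neg_one_div_eq_inv hb, inv_smul_smul₀ hB.ne']
      have h := le_lpSum hx hy (p := p) (s := s) (t := t) ⟨ht.1.le, ht.2.le⟩
      rw [lpScale_rpow_one_div hs ha hg0, lpScale_rpow_one_div hs hb hg0,
        rpow_neg_one_div_eq_inv ha, rpow_neg_one_div_eq_inv hb, inv_smul_smul₀ hA.ne',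
        inv_smul_smul₀ hB.ne', ← mul_assoc, ← mul_assoc, ← add_mul, htD, smul_smul, smul_smul,
        ← add_smul, htD] at h
      exact h
    · rw [image_eq_zero_of_notMem_tsupport hzT, Real.zero_rpow (one_div_pos.2 hs).ne', mul_zero,
        Real.zero_rpow hs.ne', ENNReal.ofReal_zero]
      exact zero_le

/-- The dilates add, so the integral of the sum is `(a + ε)^((n+s)/p) * ∫ g`, and its derivative at
`ε = 0` is explicit. -/
theorem IsSConcave.hasFirstVariation {n : ℕ} {p s a : ℝ} (hp : 1 ≤ p) (hs : 0 < s) (ha : 0 < a)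
    {g : EuclideanSpace ℝ (Fin n) → ℝ} (hg : IsSConcave s g) (h0 : 0 ∈ tsupport g)
    (hgi : Integrable g volume) :
    HasFirstVariation p s (lpScale p s a g) g
      ((∫ x, lpScale p s a g x) ^ (1 - p / (n + s)) * (∫ x, g x) ^ (p / (n + s))) := by
  have hp0 : 0 < p := by linarith
  have hns : 0 < n + s := by positivity
  have hG0 : 0 ≤ ∫ x, g x := integral_nonneg hg.1
  have hsc : ∀ {b : ℝ}, 0 < b → AEMeasurable (lpScale p s b g) volume := by
    intro b hb
    have := (hgi.comp_smul (Real.rpow_pos_of_pos hb (-(1 / p))).ne').aemeasurable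
    exact this.const_mul _
  have hsum : ∀ {ε : ℝ}, 0 < ε → lpSum p s (lpScale p s a g) (lpScale p s ε g) =
      fun z => ENNReal.ofReal (lpScale p s (a + ε) g z) := fun hε =>
    funext fun z => hg.lpSum_lpScale_lpScale hp hs ha hε h0 z
  have hF : ∫ x, lpScale p s a g x = a ^ ((n + s) / p) * ∫ x, g x := by
    rw [integral_eq_lintegral_of_nonneg_ae (Eventually.of_forall (lpScale_nonneg ha hg.1))
      (hsc ha).aestronglyMeasurable, lintegral_lpScale_eq_ofReal ha hg.1 hgi,
      ENNReal.toReal_ofReal (by positivity)]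
  have hint : ∀ {ε : ℝ}, 0 < ε → ∫⁻ z, lpSum p s (lpScale p s a g) (lpScale p s ε g) z =
      ENNReal.ofReal ((a + ε) ^ ((n + s) / p) * ∫ x, g x) := by
    intro ε hε
    rw [hsum hε, lintegral_lpScale_eq_ofReal (by positivity) hg.1 hgi]
  refine ⟨?_, (1 * ((n + s) / p) * a ^ ((n + s) / p - 1)) * ∫ x, g x, ?_, ?_⟩
  · filter_upwards [self_mem_nhdsWithin] with ε hε
    have hε' : 0 < ε := hε
    refine ⟨?_, ?_⟩
    · rw [hsum hε']
      exact (hsc (by positivity)).ennreal_ofReal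
    · rw [hint hε']
      exact ENNReal.ofReal_ne_top
  · refine ((tendsto_rpow_slope (Q := 1) (r := (n + s) / p) ha).mul_const (∫ x, g x)).congr' ?_
    filter_upwards [self_mem_nhdsWithin] with ε hε
    have hε' : 0 < ε := hε
    rw [hint hε', ENNReal.toReal_ofReal (by positivity), hF, mul_one]
    ring
  · have hκ : p / (n + s) ≠ 0 := by positivity
    -- Combining the two powers of `∫ g` requires a positive base; if it is `0`, both sides vanish.
    rcases hG0.eq_or_lt with h | h
    · rw [← h, Real.zero_rpow hκ, mul_zero, mul_zero, mul_zero]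
    · rw [hF, Real.mul_rpow (by positivity) h.le, ← Real.rpow_mul ha.le, mul_assoc,
        ← Real.rpow_add h, sub_add_cancel, Real.rpow_one,
        show (n + s) / p * (1 - p / (n + s)) = (n + s) / p - 1 by field_simp]
      field_simp

theorem mainTheorem2 (n : ℕ) (p s : ℝ) (hp : 1 ≤ p) (hs : 0 < s)
    (f g : EuclideanSpace ℝ (Fin n) → ℝ)
    (hf0 : ∀ x, 0 ≤ f x) (hg0 : ∀ x, 0 ≤ g x)
    (hf : Integrable f volume) (hg : Integrable g volume)
    (hfs : (tsupport f).Nonempty) (hgs : (tsupport g).Nonempty) :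
    (∀ S : ℝ, HasFirstVariation p s f g S →
      (∫ x, f x) ^ (1 - p / (n + s)) * (∫ x, g x) ^ (p / (n + s)) ≤ S) ∧
    ((∃ m : ℕ, s = m) → ∀ a : ℝ, 0 < a → f = lpScale p s a g → IsSConcave s g →
      (interior (tsupport g)).Nonempty → 0 ∈ tsupport g →
      HasFirstVariation p s f g
        ((∫ x, f x) ^ (1 - p / (n + s)) * (∫ x, g x) ^ (p / (n + s)))) := by
  have hp0 : 0 < p := by linarith
  have hns : 0 < n + s := by positivity
  have hκ : p / (n + s) ≠ 0 := by positivity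
  refine ⟨fun S hS => ?_, ?_⟩
  · have hS0 := hS.nonneg hp hs hf0 hg0 hf hgs
    rcases (integral_nonneg hg0 : 0 ≤ ∫ x, g x).eq_or_lt with hG | hG
    · rwa [← hG, Real.zero_rpow hκ, mul_zero]
    rcases (integral_nonneg hf0 : 0 ≤ ∫ x, f x).eq_or_lt with hF | hF
    -- For `∫ f = 0` the exponent decides: `0 ^ 0 = 1` leaves `∫ g`, while `Real.rpow` gives `0` for
    -- every nonzero exponent, including the negative ones from `p > n + s`.
    · by_cases hpn : p = n + s
      · have h1 : p / (n + s) = 1 := by rw [hpn, div_self hns.ne']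
        rw [h1, sub_self, Real.rpow_zero, one_mul, Real.rpow_one]
        exact hS.integral_le_of_integral_eq_zero hs hpn hf0 hg0 hg hfs hF.symm
      · have h1 : 1 - p / (n + s) ≠ 0 := fun h =>
          hpn (by rwa [sub_eq_zero, eq_comm, div_eq_one_iff_eq hns.ne'] at h)
        rwa [← hF, Real.zero_rpow h1, zero_mul]
    · exact hS.rpow_mul_rpow_le hp hs hf0 hg0 hf hg hF hG
  · rintro - a ha rfl hgc - h0
    exact hgc.hasFirstVariation hp hs ha h0 hg
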